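/- \textbf{Conventions.} A superring is a nontrivial unital $\mathbb Z_2$-graded ring $R=R_{\bar 0}\oplus R_{\bar 1}$ that is supercommutative ($xy=(-1)^{|x||y|}yx$ for homogeneous $x,y$) and in which $2$ is a non-zerodivisor. An ideal $\mathfrak p$ is prime (resp. maximal) if $R/\mathfrak p$ is an integral domain (resp. a field); a superideal is a graded ideal. $R$ is local if it has a unique maximal ideal $\mathfrak m$, and Noetherian if it satisfies the ascending chain condition on superideals. Put $\mathfrak J_R=R\,R_{\bar 1}$ and $\overline R=R/\mathfrak J_R$; $R$ is a superdomain (resp. superfield) if $\overline R$ is a domain (resp. a field). An ideal is regular if it contains a non-zerodivisor. Let $K(R)=S^{-1}R=S^{-1}R_{\bar 0}\oplus S^{-1}R_{\bar 1}$, where $S\subseteq R_{\bar 0}$ is the set of even non-zerodivisors of $R$. A homogeneous $b\in K(R)$ is integral over $R$ if $bM\subseteq M$ for some $M=Rb_1+\dots+Rb_n$ with all $b_i\in K(R)_{\bar 0}$ and $1\in M$; an arbitrary $b$ is integral if its homogeneous components are. $R$ is integrally closed if the integral elements of $K(R)$ are exactly those of $R$. For $a_1,\dots,a_n\in R_{\bar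 1}$, call $a_1,\dots,a_n$ a system of odd parameters if $\operatorname{Kdim}(R_{\bar 0}/\operatorname{Ann}_{R_{\bar 0}}(a_1\cdots a_n))=\operatorname{Kdim}(R_{\bar 0})$. The Krull superdimension $\operatorname{Ksdim}(R)$ is the pair $r\mid N$, where $r=\operatorname{Kdim}(R_{\bar 0})$ and $N$ is the greatest length of a system of odd parameters. A local Noetherian superring $(R,\mathfrak m)$ with residue field $\Bbbk=R/\mathfrak m=R_{\bar 0}/\mathfrak m_{\bar 0}$ is regular if $\operatorname{Ksdim}(R)=\dim_{\Bbbk}(\mathfrak m/\mathfrak m^2)_{\bar 0}\mid\dim_{\Bbbk}(\mathfrak m/\mathfrak m^2)_{\bar 1}$. A discrete valuation superring is a regular local Noetherian superdomain of Krull superdimension $1\mid N$ for some integer $N\ge 0$. \textbf{Proposition.} Let $R$ be a local Noetherian superdomain which is not a superfield, and suppose that its maximal ideal $\mathfrak m$ is regular. Assume that: (i) $R$ is integrally closed; (ii) every prime superideal of $R$ other than $\mathfrak J_R$ is maximal; (iii) for some basis $\bar z_1,\dots,\bar z_s$ of the $\Bbbk$-vector space $(\mathfrak m/\mathfrak m^2)_{\bar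 1}$ and some odd lifts $z_1,\dots,z_s\in R_{\bar 1}$ of it, the product $z^{[s]}=z_1\cdots z_s$ is nonzero (with $z^{[0]}=1$). Then $R$ is regular with $\operatorname{Ksdim}(R)=1\mid N$ for some non-negative integer $N$; that is, $R$ is a discrete valuation superring. -/

import Mathlib

namespace Superring

universe u

/-- `R = R₀ ⊕ R₁` (a `ZMod 2`-graded unital ring with homogeneous pieces `𝒜 0`, `𝒜 1`) is a
*superring*: nontrivial, supercommutative, and `2` is a non-zerodivisor. -/
class IsSuperring {R : Type u} [Ring R] (𝒜 : ZMod 2 → AddSubgroup R) [GradedRing 𝒜] : Prop where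
  nontrivial : Nontrivial R
  supercomm : ∀ (i j : ZMod 2) (x y : R), x ∈ 𝒜 i → y ∈ 𝒜 j →
    x * y = (-1) ^ (i.val * j.val) * (y * x)
  two_regular : (2 : R) ∈ nonZeroDivisors R

variable {R : Type u} [Ring R] (𝒜 : ZMod 2 → AddSubgroup R) [GradedRing 𝒜]

/-! ### The even part and the homogeneous pieces as modules over it -/

/-- The even part `R₀`, a subring of `R`. -/
def evenPart : Subring R := SetLike.GradeZero.subring 𝒜

theorem mem_evenPart {x : R} : x ∈ evenPart 𝒜 ↔ x ∈ 𝒜 0 := Iff.rfl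

/-- Even elements are central. -/
theorem even_comm [IsSuperring 𝒜] {r : R} (hr : r ∈ 𝒜 0) (x : R) : r * x = x * r := by
  induction x using DirectSum.Decomposition.inductionOn 𝒜 with
  | zero => simp
  | @homogeneous i m => simpa using IsSuperring.supercomm (𝒜 := 𝒜) 0 i r m hr m.2
  | add a b ha hb => rw [mul_add, add_mul, ha, hb]

instance evenCommRing [IsSuperring 𝒜] : CommRing (evenPart 𝒜) :=
  { (inferInstance : Ring (evenPart 𝒜)) with
    mul_comm := fun a b => Subtype.ext (even_comm 𝒜 a.2 b) }

instance evenAlgebra [IsSuperring 𝒜] : Algebra (evenPart 𝒜) R where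
  algebraMap := (evenPart 𝒜).subtype
  commutes' := fun r x => even_comm 𝒜 r.2 x
  smul_def' := fun _ _ => rfl

/-- The homogeneous piece `Rᵢ` as an `R₀`-submodule of `R`. -/
def piece [IsSuperring 𝒜] (i : ZMod 2) : Submodule (evenPart 𝒜) R where
  carrier := 𝒜 i
  add_mem' := (𝒜 i).add_mem
  zero_mem' := (𝒜 i).zero_mem
  smul_mem' := fun r x hx => by
    have h := SetLike.GradedMul.mul_mem (A := 𝒜) r.2 hx
    rwa [zero_add] at h

/-! ### Ideals -/

/-- `I` is a *prime ideal*: a two-sided ideal such that `R ⧸ I` is a (commutative) integral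
domain. -/
def IsPrimeIdeal (I : Ideal R) : Prop :=
  ∃ _ : I.IsTwoSided, IsDomain (R ⧸ I) ∧ ∀ x y : R ⧸ I, x * y = y * x

/-- `I` is a *maximal ideal*: a two-sided ideal such that `R ⧸ I` is a field. -/
def IsMaximalIdeal (I : Ideal R) : Prop :=
  ∃ _ : I.IsTwoSided, IsField (R ⧸ I)

/-- The canonical ideal `J_R = R · R₁`. -/
def canonicalIdeal : Ideal R := Ideal.span (𝒜 1 : Set R)

/-- `R` is a *superdomain*: `R ⧸ J_R` is an integral domain. -/
def IsSuperdomain : Prop := IsPrimeIdeal (canonicalIdeal 𝒜)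

/-- `R` is a *superfield*: `R ⧸ J_R` is a field. -/
def IsSuperfield : Prop := IsMaximalIdeal (canonicalIdeal 𝒜)

/-- `R` is *Noetherian*: the ascending chain condition holds for superideals (graded ideals). -/
def IsNoetherianSuperring : Prop := WellFoundedGT (HomogeneousIdeal 𝒜)

/-- `R` is *local with maximal ideal* `𝔪`: `𝔪` is the unique maximal ideal of `R`. -/
def IsLocalWith (𝔪 : Ideal R) : Prop :=
  IsMaximalIdeal 𝔪 ∧ ∀ 𝔫 : Ideal R, IsMaximalIdeal 𝔫 → 𝔫 = 𝔪

/-- `a` is a non-zerodivisor of `R`: `a ≠ 0` and `a` kills no nonzero homogeneous element. -/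
def IsNonZeroDivisor (a : R) : Prop :=
  a ≠ 0 ∧ ∀ (i : ZMod 2) (x : R), x ∈ 𝒜 i → a * x = 0 → x = 0

/-- A *regular* ideal contains a non-zerodivisor. -/
def IsRegularIdeal (I : Ideal R) : Prop := ∃ a ∈ I, IsNonZeroDivisor 𝒜 a

/-! ### The total superring of fractions and integral closedness -/

/-- The multiplicative set of the even non-zerodivisors of `R`. -/
def evenRegular [IsSuperring 𝒜] : Submonoid (evenPart 𝒜) where
  carrier := {s | IsNonZeroDivisor 𝒜 (s : R)}
  one_mem' := by
    have := IsSuperring.nontrivial (𝒜 := 𝒜)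
    exact ⟨one_ne_zero, fun i x _ h => by simpa using h⟩
  mul_mem' := by
    rintro a b ⟨ha0, ha⟩ ⟨hb0, hb⟩
    refine ⟨fun h => hb0 (ha 0 b b.2 (by simpa using h)), fun i x hx h => hb i x hx ?_⟩
    refine ha i _ ((piece 𝒜 i).smul_mem b hx) ?_
    simpa [mul_assoc] using h

/-- The total superring of fractions `K(R) = S⁻¹R = S⁻¹R₀ ⊕ S⁻¹R₁`, where `S` is the set of
even non-zerodivisors; it is a ring because `R` is an `R₀`-algebra. -/
abbrev TotalFractions [IsSuperring 𝒜] : Type u := LocalizedModule (evenRegular 𝒜) R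

/-- The homogeneous piece `K(R)ᵢ = S⁻¹Rᵢ` of `K(R)`. -/
noncomputable def fractionPiece [IsSuperring 𝒜] (i : ZMod 2) : AddSubgroup (TotalFractions 𝒜) :=
  (Submodule.localized₀ (evenRegular 𝒜) (LocalizedModule.mkLinearMap (evenRegular 𝒜) R)
    (piece 𝒜 i)).toAddSubgroup

/-- The localization morphism `R → K(R)`, `x ↦ x / 1`. -/
noncomputable def toTotalFractions [IsSuperring 𝒜] : R →+* TotalFractions 𝒜 where
  toFun x := LocalizedModule.mk x 1
  map_one' := OreLocalization.one_def.symm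
  map_mul' x y := by rw [LocalizedModule.mk_mul_mk, mul_one]
  map_zero' := LocalizedModule.zero_mk 1
  map_add' x y := by rw [LocalizedModule.mk_add_mk]; simp

section Integral

variable {K : Type*} [Ring K] (A : Subring K) (𝒦 : ZMod 2 → AddSubgroup K)

/-- A homogeneous `b ∈ K` is *integral over* `A` if `b M ⊆ M` for some `A`-submodule
`M = A c₁ + ⋯ + A cₙ` of `K` with `1 ∈ M` and all `cⱼ` even. -/
def IsIntegralHomogeneous (b : K) : Prop :=
  ∃ (n : ℕ) (c : Fin n → K), (∀ j, c j ∈ 𝒦 0) ∧ 1 ∈ Submodule.span A (Set.range c) ∧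
    ∀ x ∈ Submodule.span A (Set.range c), b * x ∈ Submodule.span A (Set.range c)

/-- `b ∈ K` is *integral over* `A` if both its homogeneous components are. -/
def IsIntegralElem (b : K) : Prop :=
  ∃ b₀ ∈ 𝒦 0, ∃ b₁ ∈ 𝒦 1, b = b₀ + b₁ ∧
    IsIntegralHomogeneous A 𝒦 b₀ ∧ IsIntegralHomogeneous A 𝒦 b₁

end Integral

/-- `R` is *integrally closed*: it equals its integral closure in `K(R)`. -/
def IsIntegrallyClosedSuperring [IsSuperring 𝒜] : Prop :=
  {b : TotalFractions 𝒜 | IsIntegralElem (toTotalFractions 𝒜).range (fractionPiece 𝒜) b} =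
    ((toTotalFractions 𝒜).range : Set (TotalFractions 𝒜))

/-! ### Krull superdimension -/

/-- The annihilator of `x` in `R₀`. -/
def evenAnn [IsSuperring 𝒜] (x : R) : Ideal (evenPart 𝒜) where
  carrier := {r | (r : R) * x = 0}
  add_mem' := fun {a b} ha hb => by
    have ha' : (a : R) * x = 0 := ha
    have hb' : (b : R) * x = 0 := hb
    simp [add_mul, ha', hb']
  zero_mem' := by simp
  smul_mem' := fun c a ha => by
    have ha' : (a : R) * x = 0 := ha
    simp [mul_assoc, ha']

/-- The ordered product `z₁ z₂ ⋯ zₛ`. -/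
def orderedProd {s : ℕ} (z : Fin s → R) : R := (List.ofFn z).prod

/-- `a₁, …, aₙ ∈ R₁` form a *system of odd parameters*:
`Kdim R₀ = Kdim (R₀ / Ann(a₁ ⋯ aₙ))`. -/
def IsSystemOfOddParameters [IsSuperring 𝒜] {n : ℕ} (a : Fin n → R) : Prop :=
  (∀ i, a i ∈ 𝒜 1) ∧
    ringKrullDim (evenPart 𝒜) = ringKrullDim (evenPart 𝒜 ⧸ evenAnn 𝒜 (orderedProd a))

/-- The even Krull superdimension: the Krull dimension of `R₀`. -/
noncomputable def evenKrullDim [IsSuperring 𝒜] : WithBot ℕ∞ := ringKrullDim (evenPart 𝒜)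

/-- The odd Krull superdimension: the greatest length of a system of odd parameters. -/
noncomputable def oddKrullDim [IsSuperring 𝒜] : ℕ∞ :=
  sSup {m : ℕ∞ | ∃ (n : ℕ) (a : Fin n → R), IsSystemOfOddParameters 𝒜 a ∧ m = n}

/-- The Krull superdimension, a pair. -/
noncomputable def krullSuperdim [IsSuperring 𝒜] : WithBot ℕ∞ × ℕ∞ :=
  (evenKrullDim 𝒜, oddKrullDim 𝒜)

/-! ### The cotangent supervector space `𝔪 / 𝔪²` over the residue field -/

/-- `I₀ = I ∩ R₀`, as an ideal of `R₀`. -/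
def evenIdeal [IsSuperring 𝒜] (I : Ideal R) : Ideal (evenPart 𝒜) where
  carrier := {r | (r : R) ∈ I}
  add_mem' := fun {_ _} ha hb => I.add_mem ha hb
  zero_mem' := I.zero_mem
  smul_mem' := fun c _ ha => I.mul_mem_left (c : R) ha

/-- The residue field `R₀ ⧸ 𝔪₀` (which is `R ⧸ 𝔪`). -/
abbrev ResidueRing [IsSuperring 𝒜] (𝔪 : Ideal R) : Type u := evenPart 𝒜 ⧸ evenIdeal 𝒜 𝔪

/-- `Iᵢ = I ∩ Rᵢ`, as an `R₀`-submodule of `R`. -/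
def idealPiece [IsSuperring 𝒜] (I : Ideal R) (i : ZMod 2) : Submodule (evenPart 𝒜) R :=
  I.restrictScalars (evenPart 𝒜) ⊓ piece 𝒜 i

/-- `(𝔪 / 𝔪²)ᵢ = 𝔪ᵢ / (𝔪²)ᵢ`. -/
abbrev CotangentPiece [IsSuperring 𝒜] (𝔪 : Ideal R) (i : ZMod 2) : Type u :=
  idealPiece 𝒜 𝔪 i ⧸ (idealPiece 𝒜 (𝔪 * 𝔪) i).submoduleOf (idealPiece 𝒜 𝔪 i)

theorem cotangentPiece_isTorsion [IsSuperring 𝒜] (𝔪 : Ideal R) (i : ZMod 2) :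
    Module.IsTorsionBySet (evenPart 𝒜) (CotangentPiece 𝒜 𝔪 i) (evenIdeal 𝒜 𝔪) := by
  rintro x ⟨r, hr⟩
  obtain ⟨y, rfl⟩ := Submodule.Quotient.mk_surjective _ x
  rw [← Submodule.Quotient.mk_smul, Submodule.Quotient.mk_eq_zero]
  exact ⟨Ideal.mul_mem_mul hr y.2.1, (piece 𝒜 i).smul_mem r y.2.2⟩

/-- The vector space structure of `(𝔪 / 𝔪²)ᵢ` over the residue field. -/
noncomputable instance cotangentModule [IsSuperring 𝒜] (𝔪 : Ideal R) (i : ZMod 2) :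
    Module (ResidueRing 𝒜 𝔪) (CotangentPiece 𝒜 𝔪 i) :=
  (cotangentPiece_isTorsion 𝒜 𝔪 i).module

/-- The superdimension of `𝔪 / 𝔪²` over the residue field. -/
noncomputable def cotangentSuperdim [IsSuperring 𝒜] (𝔪 : Ideal R) : WithBot ℕ∞ × ℕ∞ :=
  (((Module.rank (ResidueRing 𝒜 𝔪) (CotangentPiece 𝒜 𝔪 0)).toENat : ℕ∞),
    (Module.rank (ResidueRing 𝒜 𝔪) (CotangentPiece 𝒜 𝔪 1)).toENat)

/-- `(R, 𝔪)` is a *regular local superring*: local Noetherian with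
`Ksdim R = sdim (𝔪 / 𝔪²)`. -/
def IsRegularLocalWith [IsSuperring 𝒜] (𝔪 : Ideal R) : Prop :=
  IsLocalWith 𝔪 ∧ IsNoetherianSuperring 𝒜 ∧ krullSuperdim 𝒜 = cotangentSuperdim 𝒜 𝔪

/-- `R` is a *discrete valuation superring*: a regular local Noetherian superdomain of Krull
superdimension `1 | N` for some natural number `N`. -/
def IsDiscreteValuationSuperring [IsSuperring 𝒜] : Prop :=
  IsSuperdomain 𝒜 ∧ (∃ 𝔪 : Ideal R, IsRegularLocalWith 𝒜 𝔪) ∧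
    ∃ N : ℕ, krullSuperdim 𝒜 = (1, (N : ℕ∞))

end Superring

namespace Superring

universe u

variable {R : Type u} [Ring R] (𝒜 : ZMod 2 → AddSubgroup R)

/-! Everything reduces to the commutative ring `R₀`. Since products of odd elements are nilpotent,
primes `𝔭` of `R₀` lift to prime superideals `𝔭 ⊕ R₁`; hence `R₀` is local Noetherian and its only
possible primes are `J₀ = J_R ∩ R₀` and `𝔪₀` (`eq_or_eq_of_isPrime`). The classical argument for
one-dimensional integrally closed local rings then gives `𝔪₀ = (t)` with `t` regular
(`exists_generator`).

The prime `J₀` lies in `(t)` but omits `t`, so `J₀ = tJ₀`, and Nakayama gives `J₀ = 0`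
(`evenIdeal_canonicalIdeal_eq_bot`). Thus `R₀` is a discrete valuation ring, `R₁² = 0`, and `R₁` is
torsion-free over `R₀`.

A nonzero product `z₁ ⋯ zₛ` now forces `s ≤ 1`, and torsion-freeness makes `z` a system of odd
parameters. No longer one exists: for `s = 1` because `R₁² = 0`, for `s = 0` because Nakayama gives
`R₁ = 0`. Both superdimensions are therefore `1 | s`. -/

theorem mem_canonicalIdeal_of_odd {x : R} (hx : x ∈ 𝒜 1) : x ∈ canonicalIdeal 𝒜 :=
  Ideal.subset_span hx

/-! ### Even and odd components of an element. -/

variable [GradedRing 𝒜]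

theorem decompose_zero_add_decompose_one (x : R) :
    (DirectSum.decompose 𝒜 x 0 : R) + (DirectSum.decompose 𝒜 x 1 : R) = x := by
  classical
  conv_rhs => rw [← DirectSum.sum_support_decompose 𝒜 x]
  rw [Finset.sum_subset (Finset.subset_univ _) (fun i _ hi => by simpa using hi)]
  exact (Fin.sum_univ_two (fun i : ZMod 2 => (DirectSum.decompose 𝒜 x i : R))).symm

/-- The even component of an element of `R`. -/
def evenComponent (x : R) : evenPart 𝒜 := ⟨DirectSum.decompose 𝒜 x 0, SetLike.coe_mem _⟩

theorem exists_odd_eq_add (x : R) : ∃ y ∈ 𝒜 1, x = evenComponent 𝒜 x + y :=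
  ⟨_, SetLike.coe_mem (DirectSum.decompose 𝒜 x 1), (decompose_zero_add_decompose_one 𝒜 x).symm⟩

theorem evenComponent_add (x y : R) :
    evenComponent 𝒜 (x + y) = evenComponent 𝒜 x + evenComponent 𝒜 y := by
  ext; simp [evenComponent]

theorem evenComponent_coe (x : evenPart 𝒜) : evenComponent 𝒜 (x : R) = x := by
  ext; exact DirectSum.decompose_of_mem_same 𝒜 x.2

theorem evenComponent_of_odd {x : R} (hx : x ∈ 𝒜 1) : evenComponent 𝒜 x = 0 := by
  ext; exact DirectSum.decompose_of_mem_ne 𝒜 hx (by decide)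

theorem odd_mul_odd_mem {x y : R} (hx : x ∈ 𝒜 1) (hy : y ∈ 𝒜 1) : x * y ∈ 𝒜 0 :=
  SetLike.GradedMul.mul_mem (A := 𝒜) hx hy

theorem even_mul_odd_mem {x y : R} (hx : x ∈ 𝒜 0) (hy : y ∈ 𝒜 1) : x * y ∈ 𝒜 1 := by
  simpa using SetLike.GradedMul.mul_mem (A := 𝒜) hx hy

theorem odd_mul_even_mem {x y : R} (hx : x ∈ 𝒜 1) (hy : y ∈ 𝒜 0) : x * y ∈ 𝒜 1 := by
  simpa using SetLike.GradedMul.mul_mem (A := 𝒜) hx hy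

theorem evenComponent_mul (x y : R) : ∃ v ∈ 𝒜 1, ∃ w ∈ 𝒜 1,
    (evenComponent 𝒜 (x * y) : R) = evenComponent 𝒜 x * evenComponent 𝒜 y + v * w ∧
    x = evenComponent 𝒜 x + v ∧ y = evenComponent 𝒜 y + w := by
  obtain ⟨v, hv, hx⟩ := exists_odd_eq_add 𝒜 x
  obtain ⟨w, hw, hy⟩ := exists_odd_eq_add 𝒜 y
  refine ⟨v, hv, w, hw, ?_, hx, hy⟩
  set x₀ := evenComponent 𝒜 x
  set y₀ := evenComponent 𝒜 y
  let p : evenPart 𝒜 := ⟨v * w, odd_mul_odd_mem 𝒜 hv hw⟩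
  have h : x * y = ((x₀ * y₀ + p : evenPart 𝒜) : R) + (x₀ * w + v * y₀) := by
    conv_lhs => rw [hx, hy]
    simp only [p, Subring.coe_add, Subring.coe_mul, add_mul, mul_add]
    abel
  rw [h, evenComponent_add, evenComponent_coe, evenComponent_of_odd 𝒜
    (add_mem (even_mul_odd_mem 𝒜 x₀.2 hw) (odd_mul_even_mem 𝒜 hv y₀.2)), add_zero]
  rfl

/-! ### Products of odd elements. -/

variable [IsSuperring 𝒜]

theorem odd_mul_comm {x y : R} (hx : x ∈ 𝒜 1) (hy : y ∈ 𝒜 1) : x * y = -(y * x) := by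
  simpa [ZMod.val_one] using IsSuperring.supercomm (𝒜 := 𝒜) 1 1 x y hx hy

theorem odd_mul_self {x : R} (hx : x ∈ 𝒜 1) : x * x = 0 := by
  have h := odd_mul_comm 𝒜 hx hx
  have h2 : (2 : R) * (x * x) = 0 := by
    rw [two_mul]; nth_rewrite 1 [h]; simp
  exact (mem_nonZeroDivisors_iff.mp (IsSuperring.two_regular (𝒜 := 𝒜))).1 _ h2

theorem odd_mul_odd_mul_self {x y : R} (hx : x ∈ 𝒜 1) (hy : y ∈ 𝒜 1) :
    (x * y) * (x * y) = 0 := by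
  rw [← even_comm 𝒜 (odd_mul_odd_mem 𝒜 hx hy), mul_assoc, ← mul_assoc y x y,
    odd_mul_comm 𝒜 hy hx, neg_mul, mul_assoc x y y, odd_mul_self 𝒜 hy]
  simp

/-- A product of two odd elements squares to zero. Such products are exactly the failure of
`evenComponent` to be multiplicative, so it becomes a ring homomorphism modulo any prime of `R₀`. -/
theorem mem_of_coe_eq_odd_mul_odd {p : Ideal (evenPart 𝒜)} (hp : p.IsPrime) {a : evenPart 𝒜}
    {x y : R} (hx : x ∈ 𝒜 1) (hy : y ∈ 𝒜 1) (ha : (a : R) = x * y) : a ∈ p := by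
  refine (hp.mem_or_mem (x := a) (y := a) ?_).elim id id
  have : a * a = 0 := by
    ext; simp [ha, odd_mul_odd_mul_self 𝒜 hx hy]
  rw [this]; exact p.zero_mem

/-! ### Prime ideals of `R` and of `R₀` -/

/-- The projection `R → R₀ ⧸ 𝔭` attached to a prime `𝔭` of `R₀`. -/
def toQuotient (p : Ideal (evenPart 𝒜)) (hp : p.IsPrime) : R →+* evenPart 𝒜 ⧸ p where
  toFun x := Ideal.Quotient.mk p (evenComponent 𝒜 x)
  map_one' := by
    rw [← map_one (Ideal.Quotient.mk p)]; congr 1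
    exact evenComponent_coe 𝒜 1
  map_mul' x y := by
    obtain ⟨v, hv, w, hw, h, -, -⟩ := evenComponent_mul 𝒜 x y
    rw [← map_mul, Ideal.Quotient.mk_eq_mk_iff_sub_mem]
    exact mem_of_coe_eq_odd_mul_odd 𝒜 hp hv hw (by simp [h])
  map_zero' := by
    rw [← map_zero (Ideal.Quotient.mk p)]; congr 1
    exact evenComponent_coe 𝒜 0
  map_add' x y := by rw [evenComponent_add, map_add]

theorem toQuotient_surjective (p : Ideal (evenPart 𝒜)) (hp : p.IsPrime) :
    Function.Surjective (toQuotient 𝒜 p hp) := by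
  intro y
  obtain ⟨a, rfl⟩ := Ideal.Quotient.mk_surjective y
  exact ⟨a, congrArg _ (evenComponent_coe 𝒜 a)⟩

/-- The prime superideal `𝔭 ⊕ R₁` attached to a prime `𝔭` of `R₀`. -/
def primeLift (p : Ideal (evenPart 𝒜)) (hp : p.IsPrime) : Ideal R :=
  RingHom.ker (toQuotient 𝒜 p hp)

theorem mem_primeLift {p : Ideal (evenPart 𝒜)} {hp : p.IsPrime} {x : R} :
    x ∈ primeLift 𝒜 p hp ↔ evenComponent 𝒜 x ∈ p :=
  Ideal.Quotient.eq_zero_iff_mem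

instance (p : Ideal (evenPart 𝒜)) (hp : p.IsPrime) : (primeLift 𝒜 p hp).IsTwoSided :=
  inferInstanceAs (RingHom.ker (toQuotient 𝒜 p hp)).IsTwoSided

/-- `R ⧸ (𝔭 ⊕ R₁)` is `R₀ ⧸ 𝔭`. -/
noncomputable def quotientPrimeLift (p : Ideal (evenPart 𝒜)) (hp : p.IsPrime) :
    R ⧸ primeLift 𝒜 p hp ≃+* evenPart 𝒜 ⧸ p :=
  RingHom.quotientKerEquivOfSurjective (toQuotient_surjective 𝒜 p hp)

theorem isPrimeIdeal_primeLift (p : Ideal (evenPart 𝒜)) (hp : p.IsPrime) :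
    IsPrimeIdeal (primeLift 𝒜 p hp) := by
  refine ⟨inferInstance, ?_, fun x y => ?_⟩
  · have := Ideal.Quotient.isDomain p
    exact (quotientPrimeLift 𝒜 p hp).toMulEquiv.isDomain _
  · apply (quotientPrimeLift 𝒜 p hp).injective
    rw [map_mul, map_mul, mul_comm]

theorem isMaximalIdeal_primeLift (p : Ideal (evenPart 𝒜)) (hp : p.IsPrime) (hmax : p.IsMaximal) :
    IsMaximalIdeal (primeLift 𝒜 p hp) :=
  ⟨inferInstance, (quotientPrimeLift 𝒜 p hp).toMulEquiv.isField
    ((Ideal.Quotient.maximal_ideal_iff_isField_quotient p).mp hmax)⟩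

theorem isHomogeneous_primeLift (p : Ideal (evenPart 𝒜)) (hp : p.IsPrime) :
    (primeLift 𝒜 p hp).IsHomogeneous 𝒜 := by
  intro i x hx
  rw [mem_primeLift] at hx ⊢
  obtain rfl | rfl : i = 0 ∨ i = 1 := by decide +revert
  · have := evenComponent_coe 𝒜 (evenComponent 𝒜 x)
    rw [show ((DirectSum.decompose 𝒜 x 0 : 𝒜 0) : R) = (evenComponent 𝒜 x : R) from rfl, this]
    exact hx
  · rw [evenComponent_of_odd 𝒜 (SetLike.coe_mem _)]
    exact p.zero_mem

theorem evenIdeal_primeLift (p : Ideal (evenPart 𝒜)) (hp : p.IsPrime) :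
    evenIdeal 𝒜 (primeLift 𝒜 p hp) = p := by
  ext x
  change (x : R) ∈ primeLift 𝒜 p hp ↔ _
  rw [mem_primeLift, evenComponent_coe]

theorem canonicalIdeal_le_primeLift (p : Ideal (evenPart 𝒜)) (hp : p.IsPrime) :
    canonicalIdeal 𝒜 ≤ primeLift 𝒜 p hp := by
  refine Ideal.span_le.mpr fun x hx => ?_
  rw [SetLike.mem_coe, mem_primeLift, evenComponent_of_odd 𝒜 hx]
  exact p.zero_mem

theorem evenIdeal_canonicalIdeal_le (p : Ideal (evenPart 𝒜)) (hp : p.IsPrime) :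
    evenIdeal 𝒜 (canonicalIdeal 𝒜) ≤ p := fun x hx => by
  have := canonicalIdeal_le_primeLift 𝒜 p hp (show (x : R) ∈ canonicalIdeal 𝒜 from hx)
  rwa [mem_primeLift, evenComponent_coe] at this

theorem isPrime_evenIdeal {I : Ideal R} (hI : IsPrimeIdeal I) : (evenIdeal 𝒜 I).IsPrime := by
  obtain ⟨hI₂, hd, -⟩ := hI
  let f : evenPart 𝒜 →+* R ⧸ I := (Ideal.Quotient.mk I).comp (evenPart 𝒜).subtype
  have : evenIdeal 𝒜 I = RingHom.ker f := by
    ext x; exact (Ideal.Quotient.eq_zero_iff_mem (I := I)).symm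
  rw [this]
  exact RingHom.ker_isPrime f

/-! ### Finiteness of the homogeneous pieces -/

/-- For `x ∈ N` the degree `i` component of `a * x` is `a₀ * x`, because the odd part of `a` moves
`x` to the other degree. -/
theorem decompose_mem_of_mem_span {i : ZMod 2} {N : Submodule (evenPart 𝒜) R}
    (hN : N ≤ piece 𝒜 i) {x : R} (hx : x ∈ Ideal.span (N : Set R)) :
    (DirectSum.decompose 𝒜 x i : R) ∈ N := by
  -- Allowing an arbitrary left multiplier makes the statement stable under the scalar step of the
  -- induction.
  suffices h : ∀ a : R, (DirectSum.decompose 𝒜 (a * x) i : R) ∈ N by simpa using h 1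
  induction hx using Submodule.span_induction with
  | mem x h =>
    intro a
    have := DirectSum.coe_decompose_mul_add_of_right_mem 𝒜 (i := 0) (a := a) (hN h)
    rw [zero_add] at this
    rw [this]
    exact N.smul_mem (evenComponent 𝒜 a) h
  | zero => simp
  | add x y _ _ hx hy => exact fun a => by simpa [mul_add] using add_mem (hx a) (hy a)
  | smul b x _ hx => exact fun a => by simpa [mul_assoc] using hx (a * b)

/-- Extension `N ↦ RN` embeds the `R₀`-submodules of `Rᵢ` into the superideals, since `N` is
recovered as the degree `i` part of `RN`. -/
theorem isNoetherian_piece (h : IsNoetherianSuperring 𝒜) (i : ZMod 2) :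
    IsNoetherian (evenPart 𝒜) (piece 𝒜 i) := by
  have : WellFoundedGT (HomogeneousIdeal 𝒜) := h
  let f : Submodule (evenPart 𝒜) (piece 𝒜 i) → HomogeneousIdeal 𝒜 := fun N =>
    ⟨Ideal.span (N.map (piece 𝒜 i).subtype : Set R), Ideal.homogeneous_span 𝒜 _ (by
      rintro _ ⟨y, -, rfl⟩
      exact ⟨i, y.2⟩)⟩
  have hf : ∀ N N', f N ≤ f N' → N ≤ N' := fun N N' hle x hx => by
    have h₁ : (x : R) ∈ Ideal.span (N'.map (piece 𝒜 i).subtype : Set R) :=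
      hle (Ideal.subset_span ⟨x, hx, rfl⟩)
    have h₂ := decompose_mem_of_mem_span 𝒜 (Submodule.map_subtype_le _ _) h₁
    rw [DirectSum.decompose_of_mem_same 𝒜 x.2] at h₂
    obtain ⟨y, hy, hyx⟩ := h₂
    rwa [← Subtype.ext hyx]
  have hmono : Monotone f := fun N N' hle =>
    Ideal.span_mono (Set.image_mono hle)
  have : WellFoundedGT (Submodule (evenPart 𝒜) (piece 𝒜 i)) :=
    (hmono.strictMono_of_injective fun N N' he =>
      le_antisymm (hf _ _ he.le) (hf _ _ he.ge)).wellFoundedGT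
  exact isNoetherian_iff'.mpr this

theorem isNoetherianRing_evenPart (h : IsNoetherianSuperring 𝒜) :
    IsNoetherianRing (evenPart 𝒜) := by
  have := isNoetherian_piece 𝒜 h 0
  let g : evenPart 𝒜 →ₗ[evenPart 𝒜] piece 𝒜 0 :=
    (Algebra.linearMap (evenPart 𝒜) R).codRestrict _ fun x => x.2
  exact isNoetherian_of_injective g fun x y hxy =>
    Subtype.ext (congrArg (Subtype.val : piece 𝒜 0 → R) hxy)

/-! ### The local structure of `R₀` -/

section Local

variable {𝒜} {𝔪 : Ideal R}

theorem eq_evenIdeal_of_isMaximal (hloc : IsLocalWith 𝔪) (p : Ideal (evenPart 𝒜))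
    (hp : p.IsMaximal) : p = evenIdeal 𝒜 𝔪 := by
  rw [← hloc.2 _ (isMaximalIdeal_primeLift 𝒜 p hp.isPrime hp), evenIdeal_primeLift]

theorem isMaximal_evenIdeal (hloc : IsLocalWith 𝔪) : (evenIdeal 𝒜 𝔪).IsMaximal := by
  have := IsSuperring.nontrivial (𝒜 := 𝒜)
  obtain ⟨p, hp⟩ := Ideal.exists_maximal (evenPart 𝒜)
  rwa [← eq_evenIdeal_of_isMaximal hloc p hp]

theorem isLocalRing_evenPart (hloc : IsLocalWith 𝔪) : IsLocalRing (evenPart 𝒜) :=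
  .of_unique_max_ideal ⟨_, isMaximal_evenIdeal hloc, eq_evenIdeal_of_isMaximal hloc⟩

theorem primeLift_evenIdeal (hloc : IsLocalWith 𝔪) :
    primeLift 𝒜 (evenIdeal 𝒜 𝔪) (isMaximal_evenIdeal hloc).isPrime = 𝔪 :=
  hloc.2 _ (isMaximalIdeal_primeLift 𝒜 _ _ (isMaximal_evenIdeal hloc))

theorem odd_mem_of_isLocalWith (hloc : IsLocalWith 𝔪) {x : R} (hx : x ∈ 𝒜 1) : x ∈ 𝔪 := by
  rw [← primeLift_evenIdeal (𝒜 := 𝒜) hloc]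
  exact canonicalIdeal_le_primeLift 𝒜 _ _ (mem_canonicalIdeal_of_odd 𝒜 hx)

theorem eq_or_eq_of_isPrime (hloc : IsLocalWith 𝔪)
    (h_primes : ∀ 𝔭 : Ideal R, 𝔭.IsHomogeneous 𝒜 → IsPrimeIdeal 𝔭 →
      𝔭 ≠ canonicalIdeal 𝒜 → IsMaximalIdeal 𝔭) (p : Ideal (evenPart 𝒜)) (hp : p.IsPrime) :
    p = evenIdeal 𝒜 (canonicalIdeal 𝒜) ∨ p = evenIdeal 𝒜 𝔪 := by
  by_cases h : primeLift 𝒜 p hp = canonicalIdeal 𝒜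
  · left; rw [← h, evenIdeal_primeLift]
  · right
    rw [← hloc.2 _ (h_primes _ (isHomogeneous_primeLift 𝒜 p hp) (isPrimeIdeal_primeLift 𝒜 p hp) h),
      evenIdeal_primeLift]

/-- The even component `a₀` of a regular `a = a₀ + v` is itself regular. If `a₀x = 0`, then `a(vx) =
0` because `v² = 0`; hence `vx = 0`, so `ax = 0` and `x = 0`. -/
theorem exists_even_isNonZeroDivisor (hloc : IsLocalWith 𝔪) (hreg : IsRegularIdeal 𝒜 𝔪) :
    ∃ a ∈ evenIdeal 𝒜 𝔪, IsNonZeroDivisor 𝒜 (a : R) := by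
  obtain ⟨a, ha, ha0, hann⟩ := hreg
  obtain ⟨v, hv, hav⟩ := exists_odd_eq_add 𝒜 a
  set a₀ := evenComponent 𝒜 a
  refine ⟨a₀, ?_, fun h0 => ha0 ?_, fun i x hx h => ?_⟩
  · have : (a₀ : R) = a - v := by rw [hav]; simp
    change (a₀ : R) ∈ 𝔪
    rw [this]
    exact sub_mem ha (odd_mem_of_isLocalWith hloc hv)
  -- If `a₀ = 0`, then `a = v` kills `v`, which forces `a = 0`.
  · rw [h0, zero_add] at hav
    rw [hav] at hann ⊢
    exact hann 1 v hv (odd_mul_self 𝒜 hv)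
  · have hvx : v * x = 0 := by
      refine hann (1 + i) _ (SetLike.GradedMul.mul_mem (A := 𝒜) hv hx) ?_
      rw [hav, add_mul, ← mul_assoc v v, odd_mul_self 𝒜 hv, zero_mul, add_zero, ← mul_assoc,
        even_comm 𝒜 a₀.2, mul_assoc, h, mul_zero]
    exact hann i x hx (by rw [hav, add_mul, h, hvx, add_zero])

theorem IsNonZeroDivisor.eq_zero_of_mul_eq_zero {a x : evenPart 𝒜}
    (ha : IsNonZeroDivisor 𝒜 (a : R)) (h : a * x = 0) : x = 0 :=
  Subtype.ext (ha.2 0 x x.2 (congrArg Subtype.val h))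

/-- `J₀` lies in every prime of `R₀`, so its elements are nilpotent, and a regular element is not.
-/
theorem IsNonZeroDivisor.notMem_evenIdeal_canonicalIdeal {a : evenPart 𝒜}
    (ha : IsNonZeroDivisor 𝒜 (a : R)) : a ∉ evenIdeal 𝒜 (canonicalIdeal 𝒜) := fun hmem => by
  have hnil : IsNilpotent a := by
    rw [← mem_nilradical, nilradical_eq_sInf, Submodule.mem_sInf]
    exact fun p hp => evenIdeal_canonicalIdeal_le 𝒜 p hp hmem
  obtain ⟨n, hn⟩ := hnil
  induction n with
  | zero =>
    have := IsSuperring.nontrivial (𝒜 := 𝒜)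
    simp at hn
  | succ n ih => exact ih (ha.eq_zero_of_mul_eq_zero (by rw [← hn, pow_succ']))

end Local

end Superring

namespace Superring

universe u

variable {R : Type u} [Ring R] {𝒜 : ZMod 2 → AddSubgroup R} [GradedRing 𝒜] [IsSuperring 𝒜]

/-! ### Integral closedness and generators of the maximal ideal -/

theorem mk_mem_fractionPiece (i : ZMod 2) {x : R} (hx : x ∈ 𝒜 i) (s : evenRegular 𝒜) :
    (LocalizedModule.mk x s : TotalFractions 𝒜) ∈ fractionPiece 𝒜 i :=
  ⟨x, hx, s, (IsLocalizedModule.mk_eq_mk' s x).symm⟩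

theorem isIntegralHomogeneous_zero {K : Type*} [Ring K] (A : Subring K)
    (𝒦 : ZMod 2 → AddSubgroup K) (h1 : 1 ∈ 𝒦 0) : IsIntegralHomogeneous A 𝒦 0 :=
  ⟨1, fun _ => 1, fun _ => h1, Submodule.subset_span ⟨0, rfl⟩, fun x _ => by
    rw [zero_mul]; exact zero_mem _⟩

/-- The witness is the fractional ideal `M` generated by `a⁻¹I`: it contains `1 = a/a`, and `bI ⊆
aI` gives `(b/a)M ⊆ M`. -/
theorem isIntegralHomogeneous_mk {a b : evenPart 𝒜} (ha : IsNonZeroDivisor 𝒜 (a : R))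
    {I : Ideal (evenPart 𝒜)} (hI : I.FG) (haI : a ∈ I)
    (hb : ∀ x ∈ I, ∃ y ∈ I, b * x = a * y) :
    IsIntegralHomogeneous (toTotalFractions 𝒜).range (fractionPiece 𝒜)
      (LocalizedModule.mk (b : R) (⟨a, ha⟩ : evenRegular 𝒜)) := by
  set s : evenRegular 𝒜 := ⟨a, ha⟩
  obtain ⟨n, g, hg⟩ := Submodule.fg_iff_exists_fin_generating_family.mp hI
  let e : Fin n → TotalFractions 𝒜 := fun j => LocalizedModule.mk (g j : R) s
  set M := Submodule.span (toTotalFractions 𝒜).range (Set.range e)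
  have hM : ∀ x ∈ I, (LocalizedModule.mk (x : R) s : TotalFractions 𝒜) ∈ M := by
    intro x hx
    rw [← hg] at hx
    induction hx using Submodule.span_induction with
    | mem x h =>
      obtain ⟨j, rfl⟩ := h
      exact Submodule.subset_span ⟨j, rfl⟩
    | zero => simp
    | add x y _ _ hx hy =>
      have : (LocalizedModule.mk ((x + y : evenPart 𝒜) : R) s : TotalFractions 𝒜)
          = LocalizedModule.mk (x : R) s + LocalizedModule.mk (y : R) s := by
        rw [LocalizedModule.mk_add_mk, ← smul_add, LocalizedModule.mk_cancel_common_left]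
        rfl
      rw [this]; exact add_mem hx hy
    | smul r x _ hx =>
      have : (LocalizedModule.mk ((r • x : evenPart 𝒜) : R) s : TotalFractions 𝒜)
          = (⟨toTotalFractions 𝒜 r, r, rfl⟩ : (toTotalFractions 𝒜).range) •
            LocalizedModule.mk (x : R) s := by
        change _ = LocalizedModule.mk (r : R) 1 * LocalizedModule.mk (x : R) s
        rw [LocalizedModule.mk_mul_mk, one_mul]
        rfl
      rw [this]; exact M.smul_mem _ hx
  refine ⟨n, e, fun j => mk_mem_fractionPiece 0 (g j).2 s, ?_, fun x hx => ?_⟩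
  · have : (1 : TotalFractions 𝒜) = LocalizedModule.mk (a : R) s := by
      refine OreLocalization.one_def.trans (LocalizedModule.mk_eq.mpr ⟨1, ?_⟩)
      simp [s, Submonoid.smul_def, Algebra.smul_def]
      rfl
    rw [this]; exact hM a haI
  · induction hx using Submodule.span_induction with
    | mem x h =>
      obtain ⟨j, rfl⟩ := h
      obtain ⟨y, hy, hby⟩ := hb (g j) (hg ▸ Submodule.subset_span ⟨j, rfl⟩)
      have : (LocalizedModule.mk (b : R) s * e j : TotalFractions 𝒜)
          = LocalizedModule.mk (y : R) s := by
        rw [LocalizedModule.mk_mul_mk, ← LocalizedModule.mk_cancel_common_left s s (y : R)]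
        congr 1
        exact congrArg Subtype.val hby
      rw [this]; exact hM y hy
    | zero => simp
    | add x y _ _ hx hy => rw [mul_add]; exact add_mem hx hy
    | smul r x _ hx =>
      obtain ⟨_, r, rfl⟩ := r
      have : (LocalizedModule.mk (b : R) s * LocalizedModule.mk r 1 : TotalFractions 𝒜)
          = LocalizedModule.mk r 1 * LocalizedModule.mk (b : R) s := by
        rw [LocalizedModule.mk_mul_mk, LocalizedModule.mk_mul_mk, even_comm 𝒜 b.2, mul_comm s 1]
      change LocalizedModule.mk (b : R) s * (LocalizedModule.mk r 1 * x) ∈ M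
      rw [← mul_assoc, this, mul_assoc]
      exact M.smul_mem ⟨toTotalFractions 𝒜 r, r, rfl⟩ hx

theorem dvd_of_forall_mem (hclosed : IsIntegrallyClosedSuperring 𝒜) {a b : evenPart 𝒜}
    (ha : IsNonZeroDivisor 𝒜 (a : R)) {I : Ideal (evenPart 𝒜)} (hI : I.FG) (haI : a ∈ I)
    (hb : ∀ x ∈ I, ∃ y ∈ I, b * x = a * y) : a ∣ b := by
  set s : evenRegular 𝒜 := ⟨a, ha⟩
  have h1 : (1 : TotalFractions 𝒜) ∈ fractionPiece 𝒜 0 := by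
    rw [OreLocalization.one_def]; exact mk_mem_fractionPiece 0 (evenPart 𝒜).one_mem 1
  have hint : (LocalizedModule.mk (b : R) s : TotalFractions 𝒜) ∈
      {b : TotalFractions 𝒜 | IsIntegralElem (toTotalFractions 𝒜).range (fractionPiece 𝒜) b} :=
    ⟨_, mk_mem_fractionPiece 0 b.2 s, 0, zero_mem _, (add_zero _).symm,
      isIntegralHomogeneous_mk ha hI haI hb, isIntegralHomogeneous_zero _ _ h1⟩
  rw [hclosed] at hint
  obtain ⟨x, hx⟩ := hint
  obtain ⟨u, hu⟩ := LocalizedModule.mk_eq.mp (show LocalizedModule.mk x 1 = _ from hx)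
  rw [one_smul] at hu
  obtain ⟨v, hv, hxv⟩ := exists_odd_eq_add 𝒜 x
  set x₀ := evenComponent 𝒜 x
  -- The equation `u a x = u b` in `R` is projected to its even part, so the quotient `x` may be
  -- replaced by `x₀`.
  have h2 : (u : evenPart 𝒜) * (a * x₀) = u * b := by
    have h3 := congrArg (evenComponent 𝒜) hu
    have h4 : (u • s • x : R) = ((u * (a * x₀) : evenPart 𝒜) : R) + (u * a : evenPart 𝒜) * v := by
      change ((u : evenPart 𝒜) : R) * ((a : R) * x) = _
      rw [hxv]
      simp only [Subring.coe_mul, mul_add, mul_assoc]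
    rw [h4, evenComponent_add, evenComponent_coe,
      evenComponent_of_odd 𝒜 (even_mul_odd_mem 𝒜 (u * a : evenPart 𝒜).2 hv), add_zero] at h3
    exact h3.trans (evenComponent_coe 𝒜 ((u : evenPart 𝒜) * b))
  refine ⟨x₀, (sub_eq_zero.mp (IsNonZeroDivisor.eq_zero_of_mul_eq_zero u.2 ?_)).symm⟩
  rw [mul_sub, h2, sub_self]

/-- The generator is in effect `t = a/b`, where `b` spans a copy of the residue field in `R₀/(a)`.
Integral closedness prevents `b𝔪₀ ⊆ a𝔪₀`, so some `bx` is `a` times a unit. -/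
theorem exists_generator {𝔪 : Ideal R} (hloc : IsLocalWith 𝔪) (hnoeth : IsNoetherianSuperring 𝒜)
    (hreg : IsRegularIdeal 𝒜 𝔪) (hclosed : IsIntegrallyClosedSuperring 𝒜)
    (h_primes : ∀ 𝔭 : Ideal R, 𝔭.IsHomogeneous 𝒜 → IsPrimeIdeal 𝔭 →
      𝔭 ≠ canonicalIdeal 𝒜 → IsMaximalIdeal 𝔭) :
    ∃ t : evenPart 𝒜, evenIdeal 𝒜 𝔪 = Ideal.span {t} ∧ IsNonZeroDivisor 𝒜 (t : R) := by
  have := isNoetherianRing_evenPart 𝒜 hnoeth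
  have := isLocalRing_evenPart (𝒜 := 𝒜) hloc
  have hmax := isMaximal_evenIdeal (𝒜 := 𝒜) hloc
  obtain ⟨a, ham, ha⟩ := exists_even_isNonZeroDivisor (𝒜 := 𝒜) hloc hreg
  obtain ⟨b, hba, hbm⟩ : ∃ b : evenPart 𝒜, ¬ a ∣ b ∧ ∀ x ∈ evenIdeal 𝒜 𝔪, a ∣ b * x := by
    have hnt : Nontrivial (evenPart 𝒜 ⧸ Ideal.span {a}) :=
      Ideal.Quotient.nontrivial_iff.mpr
        (((Ideal.span_singleton_le_iff_mem _).mpr ham).trans_lt hmax.ne_top.lt_top).ne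
    -- An associated prime of `R₀/(a)` contains the regular element `a`, so it is not `J₀` and must
    -- be `𝔪₀`; `b` represents an element with this annihilator.
    obtain ⟨p, hp⟩ := associatedPrimes.nonempty (evenPart 𝒜) (evenPart 𝒜 ⧸ Ideal.span {a})
    rw [AssociatedPrimes.mem_iff, isAssociatedPrime_iff] at hp
    obtain ⟨hprime, y, hy⟩ := hp
    obtain ⟨b, rfl⟩ := Ideal.Quotient.mk_surjective y
    have hiff : ∀ x, x ∈ p ↔ a ∣ x * b := fun x => by
      rw [hy, Submodule.mem_colon_singleton, Submodule.mem_bot, ← Ideal.mem_span_singleton,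
        ← Ideal.Quotient.eq_zero_iff_mem]
      rfl
    have hpm : p = evenIdeal 𝒜 𝔪 := by
      refine (eq_or_eq_of_isPrime hloc h_primes p hprime).resolve_left fun h => ?_
      refine ha.notMem_evenIdeal_canonicalIdeal (h ▸ (hiff a).mpr (dvd_mul_right a b))
    refine ⟨b, fun h => hprime.ne_top ((Ideal.eq_top_iff_one _).mpr ((hiff 1).mpr (by simpa))),
      fun x hx => ?_⟩
    rw [mul_comm]; exact (hiff x).mp (hpm ▸ hx)
  -- Otherwise `b𝔪₀ ⊆ a𝔪₀`, which makes `b/a` integral and `a ∣ b`.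
  obtain ⟨x, hx, u, hu, hxu⟩ : ∃ x ∈ evenIdeal 𝒜 𝔪, ∃ u, u ∉ evenIdeal 𝒜 𝔪 ∧ b * x = a * u := by
    by_contra! hcon
    refine hba (dvd_of_forall_mem hclosed ha (IsNoetherian.noetherian _) ham fun x hx => ?_)
    obtain ⟨y, hy⟩ := hbm x hx
    exact ⟨y, by_contra fun hy' => hcon x hx y hy' hy, hy⟩
  have hunit : IsUnit u := by
    by_contra h
    exact hu (IsLocalRing.eq_maximalIdeal hmax ▸ (IsLocalRing.mem_maximalIdeal u).mpr h)
  obtain ⟨w, hw⟩ := hunit.exists_right_inv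
  set t := x * w
  have hbt : b * t = a := by rw [← mul_assoc, hxu, mul_assoc, hw, mul_one]
  have ht : t ∈ evenIdeal 𝒜 𝔪 := Ideal.mul_mem_right _ _ hx
  refine ⟨t, le_antisymm (fun y hy => ?_) ((Ideal.span_singleton_le_iff_mem _).mpr ht), ?_, ?_⟩
  -- From `by = ar` and `bt = a` follows `ay = a(tr)`, and `a` cancels.
  · obtain ⟨r, hr⟩ := hbm y hy
    refine Ideal.mem_span_singleton.mpr ⟨r, sub_eq_zero.mp (ha.eq_zero_of_mul_eq_zero ?_)⟩
    linear_combination -y * hbt + t * hr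
  · intro h0
    refine ha.1 ?_
    rw [← hbt, Subring.coe_mul, h0, mul_zero]
  · intro i y hy h0
    refine ha.2 i y hy ?_
    rw [← hbt, Subring.coe_mul, mul_assoc, h0, mul_zero]

end Superring

namespace Superring

universe u

variable {R : Type u} [Ring R] {𝒜 : ZMod 2 → AddSubgroup R} [GradedRing 𝒜]

theorem IsNonZeroDivisor.ne_zero {t : evenPart 𝒜} (ht : IsNonZeroDivisor 𝒜 (t : R)) : t ≠ 0 :=
  fun h => ht.1 (by rw [h]; rfl)

variable [IsSuperring 𝒜]

/-! ### The even part is a discrete valuation ring -/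

/-- An element of `J₀ ⊆ (t)` has the form `ty`; as `J₀` is prime and `t ∉ J₀`, also `y ∈ J₀`. So `J₀
= 𝔪₀J₀`, and Nakayama applies. -/
theorem evenIdeal_canonicalIdeal_eq_bot {𝔪 : Ideal R} (hloc : IsLocalWith 𝔪)
    (hnoeth : IsNoetherianSuperring 𝒜) (hdom : IsSuperdomain 𝒜) {t : evenPart 𝒜}
    (ht : evenIdeal 𝒜 𝔪 = Ideal.span {t}) (htreg : IsNonZeroDivisor 𝒜 (t : R)) :
    evenIdeal 𝒜 (canonicalIdeal 𝒜) = ⊥ := by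
  have := isNoetherianRing_evenPart 𝒜 hnoeth
  have := isLocalRing_evenPart (𝒜 := 𝒜) hloc
  have hJ := isPrime_evenIdeal 𝒜 hdom
  refine Submodule.eq_bot_of_le_smul_of_le_jacobson_bot (evenIdeal 𝒜 𝔪) _
    (IsNoetherian.noetherian _) (fun x hx => ?_) ?_
  · have hxm := evenIdeal_canonicalIdeal_le 𝒜 _ (isMaximal_evenIdeal hloc).isPrime hx
    rw [ht] at hxm
    obtain ⟨y, rfl⟩ := Ideal.mem_span_singleton.mp hxm
    refine Submodule.smul_mem_smul (ht ▸ Ideal.mem_span_singleton_self t) ?_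
    exact (hJ.mem_or_mem hx).resolve_left htreg.notMem_evenIdeal_canonicalIdeal
  · rw [IsLocalRing.jacobson_eq_maximalIdeal ⊥ bot_ne_top,
      IsLocalRing.eq_maximalIdeal (isMaximal_evenIdeal hloc)]

theorem odd_mul_odd_eq_zero (hJ : evenIdeal 𝒜 (canonicalIdeal 𝒜) = ⊥) {x y : R}
    (hx : x ∈ 𝒜 1) (hy : y ∈ 𝒜 1) : x * y = 0 := by
  have h : (⟨x * y, odd_mul_odd_mem 𝒜 hx hy⟩ : evenPart 𝒜) ∈ evenIdeal 𝒜 (canonicalIdeal 𝒜) :=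
    (canonicalIdeal 𝒜).mul_mem_left x (mem_canonicalIdeal_of_odd 𝒜 hy)
  rw [hJ, Ideal.mem_bot] at h
  exact congrArg Subtype.val h

theorem isDomain_evenPart (hdom : IsSuperdomain 𝒜)
    (hJ : evenIdeal 𝒜 (canonicalIdeal 𝒜) = ⊥) : IsDomain (evenPart 𝒜) := by
  have := isPrime_evenIdeal 𝒜 hdom
  rw [hJ] at this
  exact IsDomain.of_bot_isPrime _

theorem isDiscreteValuationRing_evenPart {𝔪 : Ideal R} (hloc : IsLocalWith 𝔪)
    (hnoeth : IsNoetherianSuperring 𝒜) [IsDomain (evenPart 𝒜)] {t : evenPart 𝒜}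
    (ht : evenIdeal 𝒜 𝔪 = Ideal.span {t}) (ht0 : t ≠ 0) :
    IsDiscreteValuationRing (evenPart 𝒜) := by
  have := isNoetherianRing_evenPart 𝒜 hnoeth
  have := isLocalRing_evenPart (𝒜 := 𝒜) hloc
  have hmax : IsLocalRing.maximalIdeal (evenPart 𝒜) = Ideal.span {t} := by
    rw [← ht, IsLocalRing.eq_maximalIdeal (isMaximal_evenIdeal hloc)]
  have hfield : ¬ IsField (evenPart 𝒜) := by
    rw [IsLocalRing.isField_iff_maximalIdeal_eq, hmax, Ideal.span_singleton_eq_bot]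
    exact ht0
  have hprinc : (IsLocalRing.maximalIdeal (evenPart 𝒜)).IsPrincipal := ⟨t, hmax⟩
  exact ((IsDiscreteValuationRing.TFAE _ hfield).out 0 4).mpr hprinc

/-- Torsion-freeness of the pieces: `r` is a unit times `t ^ n`, and `t` is regular on homogeneous
elements. -/
theorem smul_eq_zero_of_generator {𝔪 : Ideal R} (hloc : IsLocalWith 𝔪)
    [IsDomain (evenPart 𝒜)] [IsDiscreteValuationRing (evenPart 𝒜)] {t : evenPart 𝒜}
    (ht : evenIdeal 𝒜 𝔪 = Ideal.span {t}) (htreg : IsNonZeroDivisor 𝒜 (t : R))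
    {r : evenPart 𝒜} (hr : r ≠ 0) {i : ZMod 2} {x : R} (hx : x ∈ 𝒜 i) (h : (r : R) * x = 0) :
    x = 0 := by
  have hirr : Irreducible t := by
    rw [IsDiscreteValuationRing.irreducible_iff_uniformizer, ← ht,
      IsLocalRing.eq_maximalIdeal (isMaximal_evenIdeal hloc)]
  obtain ⟨n, u, rfl⟩ := IsDiscreteValuationRing.eq_unit_mul_pow_irreducible hr hirr
  have h' : ((t ^ n : evenPart 𝒜) : R) * x = 0 := by
    have h1 : (((u⁻¹ : (evenPart 𝒜)ˣ) * (u * t ^ n) : evenPart 𝒜) : R) * x = 0 := by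
      rw [Subring.coe_mul, mul_assoc, h, mul_zero]
    rwa [Units.inv_mul_cancel_left] at h1
  clear h hr
  induction n with
  | zero => simpa using h'
  | succ n ih =>
    refine ih (htreg.2 i _ ((piece 𝒜 i).smul_mem (t ^ n) hx) ?_)
    rw [pow_succ', Subring.coe_mul, mul_assoc] at h'
    exact h'

/-! ### The cotangent space -/

theorem mk_smul_mk_cotangentPiece (𝔪 : Ideal R) (i : ZMod 2) (r : evenPart 𝒜)
    (x : idealPiece 𝒜 𝔪 i) :
    (Ideal.Quotient.mk (evenIdeal 𝒜 𝔪) r : ResidueRing 𝒜 𝔪) •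
      (Submodule.Quotient.mk x : CotangentPiece 𝒜 𝔪 i) = Submodule.Quotient.mk (r • x) :=
  rfl

/-- Since `𝔪 = tR₀ ⊕ R₁` and `R₁² = 0`, products from `𝔪` lie in `t²R₀ ⊕ tR₁`. This controls both
degrees of the cotangent space. -/
theorem eq_smul_of_mem_mul {𝔪 : Ideal R} (hloc : IsLocalWith 𝔪)
    (hJ : evenIdeal 𝒜 (canonicalIdeal 𝒜) = ⊥) {t : evenPart 𝒜}
    (ht : evenIdeal 𝒜 𝔪 = Ideal.span {t}) {x : R} (hx : x ∈ 𝔪 * 𝔪) :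
    ∃ y : evenPart 𝒜, ∃ z ∈ 𝒜 1, x = t * (t * y + z) := by
  have hdec : ∀ x ∈ 𝔪, ∃ c : evenPart 𝒜, ∃ v ∈ 𝒜 1, x = t * c + v := fun x hx => by
    obtain ⟨v, hv, hxv⟩ := exists_odd_eq_add 𝒜 x
    have hmem : evenComponent 𝒜 x ∈ evenIdeal 𝒜 𝔪 := by
      have : (evenComponent 𝒜 x : R) = x - v := eq_sub_of_add_eq hxv.symm
      change (evenComponent 𝒜 x : R) ∈ 𝔪
      rw [this]
      exact sub_mem hx (odd_mem_of_isLocalWith hloc hv)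
    rw [ht] at hmem
    obtain ⟨c, hc⟩ := Ideal.mem_span_singleton.mp hmem
    exact ⟨c, v, hv, by rw [hxv, hc]; rfl⟩
  induction hx using Submodule.mul_induction_on' with
  | mem_mul_mem x hx y hy =>
    obtain ⟨c, v, hv, rfl⟩ := hdec x hx
    obtain ⟨d, w, hw, rfl⟩ := hdec y hy
    refine ⟨c * d, c * w + v * d, add_mem (even_mul_odd_mem 𝒜 c.2 hw) (odd_mul_even_mem 𝒜 hv d.2),
      ?_⟩
    have h1 : v * (t * d : R) = t * (v * d) := by
      rw [← mul_assoc, ← even_comm 𝒜 t.2, mul_assoc]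
    have h2 : (c : R) * (t * d) = t * (c * d) := by
      rw [← mul_assoc, even_comm 𝒜 c.2, mul_assoc]
    simp only [mul_add, add_mul, odd_mul_odd_eq_zero hJ hv hw, mul_assoc, h1, h2, Subring.coe_mul]
    abel
  | add x _ y _ hx hy =>
    obtain ⟨c, v, hv, rfl⟩ := hx
    obtain ⟨d, w, hw, rfl⟩ := hy
    refine ⟨c + d, v + w, add_mem hv hw, ?_⟩
    simp only [mul_add, Subring.coe_add]
    abel

/-- The class of `t` spans because `𝔪₀ = (t)`. It is nonzero, since `t = t²y` would make `t` a unit.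
-/
theorem rank_cotangentPiece_zero {𝔪 : Ideal R} (hloc : IsLocalWith 𝔪)
    (hJ : evenIdeal 𝒜 (canonicalIdeal 𝒜) = ⊥) [IsDomain (evenPart 𝒜)] {t : evenPart 𝒜}
    (ht : evenIdeal 𝒜 𝔪 = Ideal.span {t}) (ht0 : t ≠ 0) :
    Module.rank (ResidueRing 𝒜 𝔪) (CotangentPiece 𝒜 𝔪 0) = 1 := by
  have hmax := isMaximal_evenIdeal (𝒜 := 𝒜) hloc
  let _ : Field (ResidueRing 𝒜 𝔪) := Ideal.Quotient.field _
  have htm : t ∈ evenIdeal 𝒜 𝔪 := ht ▸ Ideal.mem_span_singleton_self t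
  let t' : idealPiece 𝒜 𝔪 0 := ⟨t, htm, t.2⟩
  rw [rank_eq_one_iff]
  refine ⟨Submodule.Quotient.mk t', fun h => ?_, fun w => ?_⟩
  · rw [Submodule.Quotient.mk_eq_zero] at h
    obtain ⟨y, z, hz, h⟩ := eq_smul_of_mem_mul hloc hJ ht h.1
    have h' := congrArg (evenComponent 𝒜) h
    have h2 : (t : R) * (t * y + z) = ((t * (t * y) : evenPart 𝒜) : R) + t * z := by
      simp [mul_add]
    rw [h2, evenComponent_add, evenComponent_coe, evenComponent_of_odd 𝒜
      (even_mul_odd_mem 𝒜 t.2 hz), add_zero] at h'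
    have h3 : t = t * (t * y) := (evenComponent_coe 𝒜 t).symm.trans h'
    have h4 : t * y = 1 := (mul_left_cancel₀ ht0 (by rw [mul_one]; exact h3)).symm
    exact hmax.ne_top (Ideal.eq_top_of_isUnit_mem _ htm (IsUnit.of_mul_eq_one _ h4))
  · obtain ⟨x, rfl⟩ := Submodule.Quotient.mk_surjective _ w
    have hx : (⟨x, x.2.2⟩ : evenPart 𝒜) ∈ evenIdeal 𝒜 𝔪 := x.2.1
    rw [ht] at hx
    obtain ⟨r, hr⟩ := Ideal.mem_span_singleton.mp hx
    refine ⟨Ideal.Quotient.mk _ r, (mk_smul_mk_cotangentPiece 𝔪 0 r t').trans (congrArg _ ?_)⟩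
    refine Subtype.ext ?_
    rw [mul_comm] at hr
    exact (congrArg Subtype.val hr).symm

/-- A vanishing odd cotangent piece means `R₁ = tR₁`; `R₁` is finitely generated over `R₀`, so
Nakayama gives `R₁ = 0`. -/
theorem odd_eq_zero_of_subsingleton {𝔪 : Ideal R} (hloc : IsLocalWith 𝔪)
    (hnoeth : IsNoetherianSuperring 𝒜) (hJ : evenIdeal 𝒜 (canonicalIdeal 𝒜) = ⊥)
    {t : evenPart 𝒜} (ht : evenIdeal 𝒜 𝔪 = Ideal.span {t})
    (hsub : Subsingleton (CotangentPiece 𝒜 𝔪 1)) {x : R} (hx : x ∈ 𝒜 1) : x = 0 := by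
  have := isLocalRing_evenPart (𝒜 := 𝒜) hloc
  have := isNoetherian_piece 𝒜 hnoeth 1
  have hbot : piece 𝒜 1 = ⊥ := by
    refine Submodule.eq_bot_of_le_smul_of_le_jacobson_bot (evenIdeal 𝒜 𝔪) _
      (Module.Finite.iff_fg.mp inferInstance) (fun x hx => ?_) ?_
    · let x' : idealPiece 𝒜 𝔪 1 := ⟨x, odd_mem_of_isLocalWith hloc hx, hx⟩
      have h : (Submodule.Quotient.mk x' : CotangentPiece 𝒜 𝔪 1) = 0 := Subsingleton.elim _ _
      rw [Submodule.Quotient.mk_eq_zero] at h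
      obtain ⟨y, z, hz, h⟩ := eq_smul_of_mem_mul hloc hJ ht h.1
      have h' : x = t * z := by
        have h1 : x - t * z = ((t * (t * y) : evenPart 𝒜) : R) := by
          rw [sub_eq_iff_eq_add, show x = _ from h]; simp [mul_add]
        have h2 := evenComponent_of_odd 𝒜 (sub_mem hx (even_mul_odd_mem 𝒜 t.2 hz))
        rw [h1, evenComponent_coe] at h2
        rw [h2] at h1
        exact sub_eq_zero.mp h1
      rw [h']
      exact Submodule.smul_mem_smul (ht ▸ Ideal.mem_span_singleton_self t) hz
    · rw [IsLocalRing.jacobson_eq_maximalIdeal ⊥ bot_ne_top,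
        IsLocalRing.eq_maximalIdeal (isMaximal_evenIdeal hloc)]
  have : x ∈ piece 𝒜 1 := hx
  rwa [hbot] at this

/-! ### The odd Krull superdimension -/

theorem orderedProd_eq_zero (hJ : evenIdeal 𝒜 (canonicalIdeal 𝒜) = ⊥) {n : ℕ} (hn : 2 ≤ n)
    (a : Fin n → R) (ha : ∀ i, a i ∈ 𝒜 1) : orderedProd a = 0 := by
  obtain ⟨n, rfl⟩ := Nat.exists_eq_add_of_le' hn
  simp only [orderedProd, List.ofFn_succ, List.prod_cons]
  rw [← mul_assoc, odd_mul_odd_eq_zero hJ (ha _) (ha _), zero_mul]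

/-- A zero product has annihilator `R₀`; the quotient is then the zero ring, of dimension `⊥`,
whereas `R₀` has dimension at least `0`. -/
theorem IsSystemOfOddParameters.orderedProd_ne_zero {n : ℕ} {a : Fin n → R}
    (ha : IsSystemOfOddParameters 𝒜 a) : orderedProd a ≠ 0 := fun h => by
  have := IsSuperring.nontrivial (𝒜 := 𝒜)
  have htop : evenAnn 𝒜 (orderedProd a) = ⊤ := by
    rw [Ideal.eq_top_iff_one, h]
    exact mul_zero _
  have h2 := ha.2
  have : Subsingleton (evenPart 𝒜 ⧸ evenAnn 𝒜 (orderedProd a)) :=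
    Ideal.Quotient.subsingleton_iff.mpr htop
  rw [ringKrullDim_eq_bot_of_subsingleton (R := evenPart 𝒜 ⧸ _)] at h2
  exact absurd (ringKrullDim_nonneg_of_nontrivial (R := evenPart 𝒜)) (by simp [h2])

theorem isSystemOfOddParameters_of_evenAnn_eq_bot {n : ℕ} {a : Fin n → R}
    (ha : ∀ i, a i ∈ 𝒜 1) (h : evenAnn 𝒜 (orderedProd a) = ⊥) :
    IsSystemOfOddParameters 𝒜 a :=
  ⟨ha, by rw [h]; exact (ringKrullDim_eq_of_ringEquiv (RingEquiv.quotientBot _)).symm⟩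

theorem oddKrullDim_eq {s : ℕ} (hs : ∃ a : Fin s → R, IsSystemOfOddParameters 𝒜 a)
    (hle : ∀ (n : ℕ) (a : Fin n → R), IsSystemOfOddParameters 𝒜 a → n ≤ s) :
    oddKrullDim 𝒜 = s := by
  refine IsGreatest.csSup_eq ⟨hs.imp' s fun a ha => ?_, ?_⟩
  · exact ⟨a, ha, rfl⟩
  · rintro _ ⟨n, a, ha, rfl⟩
    exact Nat.cast_le.mpr (hle n a ha)

end Superring

theorem mainTheorem3 {R : Type*} [Ring R] (𝒜 : ZMod 2 → AddSubgroup R) [GradedRing 𝒜]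
    [Superring.IsSuperring 𝒜] (𝔪 : Ideal R)
    (h_local : Superring.IsLocalWith 𝔪)
    (h_noeth : Superring.IsNoetherianSuperring 𝒜)
    (h_domain : Superring.IsSuperdomain 𝒜)
    (h_not_field : ¬ Superring.IsSuperfield 𝒜)
    (h_regular : Superring.IsRegularIdeal 𝒜 𝔪)
    (h_closed : Superring.IsIntegrallyClosedSuperring 𝒜)
    (h_primes : ∀ 𝔭 : Ideal R, 𝔭.IsHomogeneous 𝒜 → Superring.IsPrimeIdeal 𝔭 →
      𝔭 ≠ Superring.canonicalIdeal 𝒜 → Superring.IsMaximalIdeal 𝔭)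
    (h_basis : ∃ (s : ℕ) (z : Fin s → Superring.idealPiece 𝒜 𝔪 1)
      (b : Module.Basis (Fin s) (Superring.ResidueRing 𝒜 𝔪) (Superring.CotangentPiece 𝒜 𝔪 1)),
      (∀ i, b i = Submodule.Quotient.mk (z i)) ∧
        Superring.orderedProd (fun i => (z i : R)) ≠ 0) :
    Superring.IsRegularLocalWith 𝒜 𝔪 ∧
      (∃ N : ℕ, Superring.krullSuperdim 𝒜 = (1, (N : ℕ∞))) ∧
      Superring.IsDiscreteValuationSuperring 𝒜 := by
  open Superring in
  obtain ⟨t, ht, htreg⟩ := exists_generator h_local h_noeth h_regular h_closed h_primes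
  have hJ := evenIdeal_canonicalIdeal_eq_bot h_local h_noeth h_domain ht htreg
  have ht0 := htreg.ne_zero
  have := isDomain_evenPart h_domain hJ
  have := isDiscreteValuationRing_evenPart h_local h_noeth ht ht0
  obtain ⟨s, z, b, -, hprod⟩ := h_basis
  have hmax := isMaximal_evenIdeal (𝒜 := 𝒜) h_local
  have hz : ∀ i, (z i : R) ∈ 𝒜 1 := fun i => (z i).2.2
  have hs : s < 2 := by
    by_contra! h
    exact hprod (orderedProd_eq_zero hJ h _ hz)
  -- Regularity of `t` is tested on homogeneous elements only, so the product must be seen to be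
  -- homogeneous: it is `1` or `z₁`.
  have hmem : ∃ i, orderedProd (fun i => (z i : R)) ∈ 𝒜 i := by
    interval_cases s
    · exact ⟨0, (evenPart 𝒜).one_mem⟩
    · exact ⟨1, by simpa [orderedProd] using hz 0⟩
  obtain ⟨i, hi⟩ := hmem
  have hsys : IsSystemOfOddParameters 𝒜 (fun i => (z i : R)) := by
    refine isSystemOfOddParameters_of_evenAnn_eq_bot hz ((Submodule.eq_bot_iff _).mpr fun r hr => ?_)
    by_contra hr0
    exact hprod (smul_eq_zero_of_generator h_local ht htreg hr0 hi hr)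
  have hodd : oddKrullDim 𝒜 = s := by
    refine oddKrullDim_eq ⟨_, hsys⟩ fun n a ha => ?_
    by_contra! hn
    refine ha.orderedProd_ne_zero ?_
    -- For `s = 0` the empty basis makes the odd cotangent piece zero, so `R₁ = 0`; for `s = 1` a
    -- longer system has at least two odd factors.
    interval_cases s
    · obtain ⟨n, rfl⟩ := Nat.exists_eq_add_of_le' hn
      have := odd_eq_zero_of_subsingleton h_local h_noeth hJ ht b.repr.toEquiv.subsingleton
        (ha.1 0)
      simp [orderedProd, List.ofFn_succ, this]
    · exact orderedProd_eq_zero hJ hn a ha.1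
  have hdim : krullSuperdim 𝒜 = (1, (s : ℕ∞)) := by
    rw [krullSuperdim, evenKrullDim, hodd, IsPrincipalIdealRing.ringKrullDim_eq_one _
      (IsDiscreteValuationRing.not_isField _)]
  have hcot : cotangentSuperdim 𝒜 𝔪 = (1, (s : ℕ∞)) := by
    have : Nontrivial (ResidueRing 𝒜 𝔪) := Ideal.Quotient.nontrivial_iff.mpr hmax.ne_top
    rw [cotangentSuperdim, rank_cotangentPiece_zero h_local hJ ht ht0, rank_eq_card_basis b]
    simp
  have hreg : IsRegularLocalWith 𝒜 𝔪 := ⟨h_local, h_noeth, hdim.trans hcot.symm⟩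
  exact ⟨hreg, ⟨s, hdim⟩, h_domain, ⟨𝔪, hreg⟩, s, hdim⟩
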